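/- Fix $\alpha,\beta\in[0,\pi)$ and a real-valued weight $\omega$ on $[0,1]$ which is monotonic on $[0,1]$ (H1) and satisfies $\inf_{x\in[0,1]}\omega(x)>0$ (H2). For $q\in L^1([0,1],\mathbb R)$ consider the Sturm–Liouville eigenvalue problem $$-y''(x)+q(x)y(x)=\lambda\,\omega(x)y(x)\ \text{ a.e. on }[0,1],$$ $$y(0)\cos\alpha+y'(0)\sin\alpha=0,\qquad y(1)\cos\beta+y'(1)\sin\beta=0,$$ where solutions are complex-valued functions $y$ with $y,y'$ absolutely continuous on $[0,1]$. Its eigenvalues form a sequence $\lambda_1(q)<\lambda_2(q)<\cdots$ of real numbers; a nontrivial solution $\varphi$ of the problem is called a normalized eigenfunction if $\int_0^1\omega|\varphi|^2\,dx=1$. Then for every norm-bounded subset $\Omega\subset L^1([0,1],\mathbb R)$ there is a constant $M(\Omega)>0$ (depending on $\alpha,\beta,\omega$ and $\Omega$ only) such that for every $q\in\Omega$ and every normalized eigenfunction $\varphi$ belonging to any eigenvalue of the problem with potential $q$ (that is, to $\lambda_n(q)$ for any $n\ge 1$), one has $$|\varphi(x)|\le M(\Omega)\qquad\text{for all }x\in[0,1].$$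 -/

import Mathlib

open Set MeasureTheory

noncomputable section

namespace SturmLiouville

/-- Lebesgue measure on the unit interval `[0,1]`. -/
abbrev μI : Measure ℝ := volume.restrict (Icc (0 : ℝ) 1)

/-- The Banach space `L¹([0,1], ℝ)` of real potentials, with its usual norm. -/
abbrev L1 : Type := Lp ℝ 1 μI

/-- The derivative `y'` of `y` on `[0,1]`, one-sided at the two endpoints. -/
def D (y : ℝ → ℂ) : ℝ → ℂ := derivWithin y (Icc (0 : ℝ) 1)

/-- `y` is a (Carathéodory) solution on `[0,1]` of `-y'' + q y = lam ω y`: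
`y` is differentiable, `y'` is absolutely continuous on `[0,1]` (hence so is `y`),
and the equation holds almost everywhere. -/
structure IsSolution (ω q : ℝ → ℝ) (lam : ℂ) (y : ℝ → ℂ) : Prop where
  differentiableOn : DifferentiableOn ℝ y (Icc (0 : ℝ) 1)
  absolutelyContinuous : AbsolutelyContinuousOnInterval (D y) 0 1
  equation : ∀ᵐ x ∂μI, -(D (D y) x) + (q x : ℂ) * y x = lam * (ω x : ℂ) * y x

/-- `y` is an eigenfunction with eigenvalue `lam` of `-y'' + q y = lam ω y` on `[0,1]` with
boundary conditions `y(0) cos α + y'(0) sin α = 0` and `y(1) cos β + y'(1) sin β = 0`. -/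
structure IsEigenfunction (α β : ℝ) (ω q : ℝ → ℝ) (lam : ℂ) (y : ℝ → ℂ) : Prop where
  solution : IsSolution ω q lam y
  boundary_zero : y 0 * (Real.cos α : ℂ) + D y 0 * (Real.sin α : ℂ) = 0
  boundary_one : y 1 * (Real.cos β : ℂ) + D y 1 * (Real.sin β : ℂ) = 0
  nontrivial : ∃ x ∈ Icc (0 : ℝ) 1, y x ≠ 0

/-- The weighted norm `‖f‖_ω = (∫₀¹ ω |f|²)^(1/2)`. -/
def weightedNorm (ω : ℝ → ℝ) (f : ℝ → ℂ) : ℝ :=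
  Real.sqrt (∫ x in (0 : ℝ)..1, ω x * ‖f x‖ ^ 2)

/-- A normalized eigenfunction: an eigenfunction `y` with `‖y‖_ω = 1`. -/
def IsNormalizedEigenfunction (α β : ℝ) (ω q : ℝ → ℝ) (lam : ℂ) (y : ℝ → ℂ) : Prop :=
  IsEigenfunction α β ω q lam y ∧ weightedNorm ω y = 1

end SturmLiouville

end

/-!
For a normalized eigenfunction `φ` with eigenvalue `lam`, put `g = |φ|²`, `r = Re (φ̄ φ')` and
`p = |φ'|²`. Integrating `(φ̄ φ')' = |φ'|² + (q - lam ω) |φ|²` over `[0,1]` shows that `lam` is real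
(`IsEigenfunction.im_eq_zero`) and that `∫ p ≤ lam + C max g` (`IsEnergyTriple.integral_p_le`), where
`C` bounds the boundary coefficients and `‖q‖`.

If `lam` stays below a threshold, the second fact and a Sobolev inequality bound `max g`
(`IsEnergyTriple.le_of_small`).

If `lam` is large, consider the energy `E = p + lam ω g` and its rescaling `E / ω = p / ω + lam g`.
Formally `dE = 2 q r + lam g dω` and `d(E / ω) = 2 q r / ω + p d(1/ω)`, so for monotone `ω` the two
energies vary in opposite directions apart from the terms with `q`, which are of relative size
`‖q‖ / √lam` because `2 √(lam ω) |r| ≤ E`. Hence all values of `E` are comparable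
(`IsEnergyTriple.exists_endpoint`). The mean of `E` is `∫ p + lam ≤ 2 lam + C max g`, while
`lam ω₀ g ≤ E` for a lower bound `ω₀ > 0` of `ω`; together they bound `g` independently of `lam`
(`IsEnergyTriple.le_of_large`). As `ω` may jump, the signs of the Stieltjes terms are obtained from a
partition argument (`integral_mul_deriv_le_of_monotoneOn`).
-/

open Set MeasureTheory

namespace SturmLiouville

/-! ### Absolutely continuous functions -/

lemma _root_.AbsolutelyContinuousOnInterval.comp_lipschitz {X Y : Type*} [PseudoMetricSpace X]
    [PseudoMetricSpace Y] {f : ℝ → X} {F : X → Y} {K : NNReal} {a b : ℝ}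
    (hF : LipschitzWith K F) (hf : AbsolutelyContinuousOnInterval f a b) :
    AbsolutelyContinuousOnInterval (fun x => F (f x)) a b := by
  have h0 : Filter.Tendsto (fun E : ℕ × (ℕ → ℝ × ℝ) =>
      (K : ℝ) * ∑ i ∈ Finset.range E.1, dist (f (E.2 i).1) (f (E.2 i).2))
      (AbsolutelyContinuousOnInterval.totalLengthFilter ⊓
        Filter.principal (AbsolutelyContinuousOnInterval.disjWithin a b)) (nhds 0) := by
    simpa using Filter.Tendsto.const_mul (K : ℝ) hf
  refine squeeze_zero (fun E => Finset.sum_nonneg fun i _ => dist_nonneg) (fun E => ?_) h0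
  rw [Finset.mul_sum]
  exact Finset.sum_le_sum fun i _ => hF.dist_le_mul _ _

lemma _root_.AbsolutelyContinuousOnInterval.of_hasDerivWithinAt {E : Type*}
    [NormedAddCommGroup E] [NormedSpace ℝ E] {f f' : ℝ → E} {a b : ℝ} (hab : a ≤ b)
    (hf : ∀ x ∈ Icc a b, HasDerivWithinAt f (f' x) (Icc a b) x)
    (hf' : ContinuousOn f' (Icc a b)) : AbsolutelyContinuousOnInterval f a b := by
  obtain ⟨C, hC⟩ := isCompact_Icc.exists_bound_of_continuousOn hf'
  have := (convex_Icc a b).lipschitzOnWith_of_nnnorm_hasDerivWithin_le (C := C.toNNReal) hf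
    (fun x hx => by
      rw [← NNReal.coe_le_coe, coe_nnnorm]
      exact (hC x hx).trans (Real.le_coe_toNNReal C))
  exact LipschitzOnWith.absolutelyContinuousOnInterval (by rwa [uIcc_of_le hab])

lemma _root_.AbsolutelyContinuousOnInterval.integral_eq_sub_of_ae_hasDerivAt {f f' : ℝ → ℝ}
    {a b : ℝ} (hf : AbsolutelyContinuousOnInterval f a b)
    (hd : ∀ᵐ x, x ∈ uIcc a b → HasDerivAt f (f' x) x) :
    ∫ x in a..b, f' x = f b - f a := by
  rw [← hf.integral_deriv_eq_sub]
  refine intervalIntegral.integral_congr_ae ?_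
  filter_upwards [hd] with x hx hxI
  exact (hx (uIoc_subset_uIcc hxI)).deriv.symm

lemma _root_.AbsolutelyContinuousOnInterval.ae_differentiableAt_complex {f : ℝ → ℂ} {a b : ℝ}
    (hf : AbsolutelyContinuousOnInterval f a b) :
    ∀ᵐ x, x ∈ uIcc a b → DifferentiableAt ℝ f x := by
  have hre := (hf.comp_lipschitz Complex.reCLM.lipschitz).ae_differentiableAt
  have him := (hf.comp_lipschitz Complex.imCLM.lipschitz).ae_differentiableAt
  filter_upwards [hre, him] with x h1 h2 hx
  have := (Complex.ofRealCLM.differentiableAt.comp x (h1 hx)).add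
    ((Complex.ofRealCLM.differentiableAt.comp x (h2 hx)).mul_const Complex.I)
  refine this.congr_of_eventuallyEq (Filter.Eventually.of_forall fun t => ?_)
  simp [Complex.re_add_im]

/-! ### Integration by parts against a monotone weight -/

lemma intervalIntegrable_mul_of_monotoneOn {w f : ℝ → ℝ} {s t : ℝ} (hst : s ≤ t)
    (hw : MonotoneOn w (Icc s t)) (hi : IntervalIntegrable f volume s t) :
    IntervalIntegrable (fun x => w x * f x) volume s t := by
  rw [intervalIntegrable_iff_integrableOn_Ioc_of_le hst] at hi ⊢
  have hm : AEStronglyMeasurable w (volume.restrict (Ioc s t)) :=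
    ((MonotoneOn.intervalIntegrable (μ := volume) (a := s) (b := t) (by rwa [uIcc_of_le hst])).1).aestronglyMeasurable
  refine Integrable.bdd_mul (c := max |w s| |w t|) hi hm ?_
  refine (ae_restrict_iff' measurableSet_Ioc).2 (Filter.Eventually.of_forall fun x hx => ?_)
  have hx' := Ioc_subset_Icc_self hx
  exact abs_le_max_abs_abs (hw (left_mem_Icc.2 hst) hx' hx'.1) (hw hx' (right_mem_Icc.2 hst) hx'.2)

/-- The one-step estimate for `integral_mul_deriv_le_of_monotoneOn`: freezing `w` at the left
endpoint costs the oscillation of `w` times the variation of `f`. -/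
lemma integral_mul_deriv_increment_le {w f f' : ℝ → ℝ} {s t : ℝ} (hst : s ≤ t)
    (hw : MonotoneOn w (Icc s t)) (hft : 0 ≤ f t) (hi : IntervalIntegrable f' volume s t)
    (hf : ∫ x in s..t, f' x = f t - f s) :
    ∫ x in s..t, w x * f' x ≤ w t * f t - w s * f s + (w t - w s) * ∫ x in s..t, |f' x| := by
  have hs : s ∈ Icc s t := left_mem_Icc.2 hst
  have ht : t ∈ Icc s t := right_mem_Icc.2 hst
  have hwi := intervalIntegrable_mul_of_monotoneOn hst hw hi
  have key : ∫ x in s..t, (w x * f' x - w s * f' x) ≤ ∫ x in s..t, (w t - w s) * |f' x| := by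
    refine intervalIntegral.integral_mono_on hst (hwi.sub (hi.const_mul _))
      (hi.abs.const_mul _) fun x hx => ?_
    have h1 := hw hs hx hx.1
    have h2 := hw hx ht hx.2
    calc w x * f' x - w s * f' x = (w x - w s) * f' x := by ring
      _ ≤ (w x - w s) * |f' x| := mul_le_mul_of_nonneg_left (le_abs_self _) (by linarith)
      _ ≤ (w t - w s) * |f' x| := mul_le_mul_of_nonneg_right (by linarith) (abs_nonneg _)
  rw [intervalIntegral.integral_sub hwi (hi.const_mul _), intervalIntegral.integral_const_mul,
    intervalIntegral.integral_const_mul, hf] at key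
  nlinarith [mul_nonneg (sub_nonneg.2 (hw hs ht hst)) hft]

/-- Integration by parts against a monotone weight, with the nonnegative term `∫ f dw` dropped. The
weight may jump, so no Stieltjes measure is formed: over a fine partition the errors of
`integral_mul_deriv_increment_le` telescope to at most `ε (w b - w a)`. -/
theorem integral_mul_deriv_le_of_monotoneOn {w f f' : ℝ → ℝ} {a b : ℝ} (hab : a ≤ b)
    (hw : MonotoneOn w (Icc a b)) (hf0 : ∀ x ∈ Icc a b, 0 ≤ f x)
    (hi : IntervalIntegrable f' volume a b)
    (hf : ∀ x ∈ Icc a b, ∀ y ∈ Icc a b, ∫ t in x..y, f' t = f y - f x) :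
    ∫ x in a..b, w x * f' x ≤ w b * f b - w a * f a := by
  have ha : a ∈ Icc a b := left_mem_Icc.2 hab
  have hb : b ∈ Icc a b := right_mem_Icc.2 hab
  have hwab := hw ha hb hab
  have hsub : ∀ {s t}, s ∈ Icc a b → t ∈ Icc a b → uIcc s t ⊆ uIcc a b := by
    intro s t hs ht
    rw [uIcc_of_le hab]
    exact ordConnected_Icc.uIcc_subset hs ht
  suffices h : ∀ ε > 0, ∫ x in a..b, w x * f' x ≤
      w b * f b - w a * f a + (w b - w a) * ε by
    refine le_of_forall_pos_le_add fun δ hδ => ?_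
    refine (h (δ / (w b - w a + 1)) (by have : 0 < w b - w a + 1 := by linarith
                                        positivity)).trans ?_
    have h1 : 0 < w b - w a + 1 := by linarith
    have : (w b - w a) * (δ / (w b - w a + 1)) ≤ δ := by
      rw [← mul_div_assoc, div_le_iff₀ h1]
      nlinarith
    linarith
  intro ε hε
  -- The primitive of `|f'|` is uniformly continuous.
  have hcont : ContinuousOn (fun x => ∫ t in a..x, |f' t|) (Icc a b) := by
    have := intervalIntegral.continuousOn_primitive_interval' (a := a) hi.abs left_mem_uIcc
    rwa [uIcc_of_le hab] at this
  obtain ⟨δ, hδ, hδε⟩ := Metric.uniformContinuousOn_iff.1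
    (isCompact_Icc.uniformContinuousOn_of_continuous hcont) ε hε
  obtain ⟨n, hn⟩ := exists_nat_gt ((b - a) / δ)
  have hn0 : (0 : ℝ) < n := lt_of_le_of_lt (div_nonneg (by linarith) hδ.le) hn
  set t : ℕ → ℝ := fun i => a + i * ((b - a) / n) with ht
  have hstep : (b - a) / n < δ := by
    rw [div_lt_iff₀ hδ] at hn
    rw [div_lt_iff₀ hn0]
    linarith
  have hstep0 : 0 ≤ (b - a) / n := div_nonneg (by linarith) hn0.le
  have htn : t n = b := by
    simp only [ht]
    field_simp
    ring
  have hts : ∀ i, t (i + 1) = t i + (b - a) / n := fun i => by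
    simp only [ht]
    push_cast
    ring
  have htm : ∀ i ≤ n, t i ∈ Icc a b := fun i hin => by
    have h1 : (i : ℝ) ≤ n := by exact_mod_cast hin
    refine ⟨by simp only [ht]; nlinarith [(Nat.cast_nonneg i : (0 : ℝ) ≤ i)], ?_⟩
    rw [← htn]
    simp only [ht]
    nlinarith
  have hwi := intervalIntegrable_mul_of_monotoneOn hab hw hi
  have main : ∀ i ≤ n, ∫ x in a..t i, w x * f' x ≤
      w (t i) * f (t i) - w a * f a + (w (t i) - w a) * ε := by
    intro i
    induction i with
    | zero => intro _; simp [ht]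
    | succ i ih =>
      intro hin
      have hi0 := htm i (by omega)
      have hi1 := htm (i + 1) hin
      have hle : t i ≤ t (i + 1) := by rw [hts]; linarith
      have hinc := integral_mul_deriv_increment_le hle (hw.mono (Icc_subset_Icc hi0.1 hi1.2))
        (hf0 _ hi1) (hi.mono_set (hsub hi0 hi1)) (hf _ hi0 _ hi1)
      have hsmall : ∫ x in t i..t (i + 1), |f' x| ≤ ε := by
        have hd := hδε _ hi1 _ hi0 (by
          rw [Real.dist_eq, hts, add_sub_cancel_left, abs_of_nonneg hstep0]
          exact hstep)
        rw [Real.dist_eq, intervalIntegral.integral_interval_sub_left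
          (hi.abs.mono_set (hsub ha hi1)) (hi.abs.mono_set (hsub ha hi0))] at hd
        exact (le_abs_self _).trans hd.le
      have hadd := intervalIntegral.integral_add_adjacent_intervals
        (hwi.mono_set (hsub ha hi0)) (hwi.mono_set (hsub hi0 hi1))
      have hwm := mul_le_mul_of_nonneg_left hsmall (sub_nonneg.2 (hw hi0 hi1 hle))
      have := ih (by omega)
      rw [← hadd]
      linarith
  simpa [htn] using main n le_rfl

theorem le_integral_mul_deriv_of_antitoneOn {w f f' : ℝ → ℝ} {a b : ℝ} (hab : a ≤ b)
    (hw : AntitoneOn w (Icc a b)) (hf0 : ∀ x ∈ Icc a b, 0 ≤ f x)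
    (hi : IntervalIntegrable f' volume a b)
    (hf : ∀ x ∈ Icc a b, ∀ y ∈ Icc a b, ∫ t in x..y, f' t = f y - f x) :
    w b * f b - w a * f a ≤ ∫ x in a..b, w x * f' x := by
  have := integral_mul_deriv_le_of_monotoneOn hab hw.neg hf0 hi hf
  simp only [neg_mul, intervalIntegral.integral_neg] at this
  linarith


/-! ### Energy estimates -/

/-- The quadratic quantities `g = |y|²`, `r = Re (ȳ y')`, `p = |y'|²` of a solution `y` of
`-y'' + q y = lam ω y` with real `lam`, described by the linear system `g' = 2 r`,
`p' = 2 (q - lam ω) r`, `r' = p + (q - lam ω) g` that they satisfy. The system is recorded in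
integrated form, the last equation only over the whole interval. -/
structure IsEnergyTriple (ω q : ℝ → ℝ) (lam : ℝ) (g r p : ℝ → ℝ) : Prop where
  g_nonneg : ∀ x ∈ Icc (0 : ℝ) 1, 0 ≤ g x
  p_nonneg : ∀ x ∈ Icc (0 : ℝ) 1, 0 ≤ p x
  sq_le : ∀ x ∈ Icc (0 : ℝ) 1, r x ^ 2 ≤ g x * p x
  cont_g : ContinuousOn g (Icc 0 1)
  cont_r : ContinuousOn r (Icc 0 1)
  cont_p : ContinuousOn p (Icc 0 1)
  integral_g : ∀ x ∈ Icc (0 : ℝ) 1, ∀ y ∈ Icc (0 : ℝ) 1, ∫ t in x..y, 2 * r t = g y - g x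
  integral_p : ∀ x ∈ Icc (0 : ℝ) 1, ∀ y ∈ Icc (0 : ℝ) 1,
    ∫ t in x..y, 2 * (q t - lam * ω t) * r t = p y - p x
  integral_r : ∫ t in (0 : ℝ)..1, (p t + (q t - lam * ω t) * g t) = r 1 - r 0

variable {ω q : ℝ → ℝ} {lam : ℝ} {g r p : ℝ → ℝ}

lemma uIcc_subset_unit {x y : ℝ} (hx : x ∈ Icc (0 : ℝ) 1) (hy : y ∈ Icc (0 : ℝ) 1) :
    uIcc x y ⊆ uIcc 0 1 := by
  rw [uIcc_of_le zero_le_one]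
  exact ordConnected_Icc.uIcc_subset hx hy

lemma intervalIntegrable_mul_unit {m f : ℝ → ℝ} (hm : IntervalIntegrable m volume 0 1)
    (hf : ContinuousOn f (Icc 0 1)) : IntervalIntegrable (fun t => m t * f t) volume 0 1 :=
  hm.mul_continuousOn (by rwa [uIcc_of_le zero_le_one])

lemma intervalIntegrable_weight (hω : MonotoneOn ω (Icc 0 1) ∨ AntitoneOn ω (Icc 0 1)) :
    IntervalIntegrable ω volume 0 1 := by
  rcases hω with hω | hω
  · exact MonotoneOn.intervalIntegrable (by rwa [uIcc_of_le zero_le_one])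
  · exact AntitoneOn.intervalIntegrable (by rwa [uIcc_of_le zero_le_one])

/-- The perturbation caused by the potential: `∫ m · q · 2r` is small relative to the energy,
because `R` will be of order `energy / √lam`. -/
lemma abs_integral_potential_le {m : ℝ → ℝ} {B R Q x y : ℝ} (hB : 0 ≤ B) (hR : 0 ≤ R)
    (hq : IntervalIntegrable q volume 0 1) (hQ : ∫ t in (0 : ℝ)..1, |q t| ≤ Q)
    (hm : ∀ t ∈ Icc (0 : ℝ) 1, |m t| ≤ B) (hr : ∀ t ∈ Icc (0 : ℝ) 1, |r t| ≤ R)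
    (hx : x ∈ Icc (0 : ℝ) 1) (hy : y ∈ Icc (0 : ℝ) 1) (hxy : x ≤ y) :
    |∫ t in x..y, m t * (q t * (2 * r t))| ≤ 2 * B * Q * R := by
  have hqa := (hq.abs.const_mul (B * (2 * R)))
  have h1 : |∫ t in x..y, m t * (q t * (2 * r t))| ≤ ∫ t in x..y, B * (2 * R) * |q t| := by
    rw [← Real.norm_eq_abs]
    refine intervalIntegral.norm_integral_le_of_norm_le hxy ?_
      (hqa.mono_set (uIcc_subset_unit hx hy))
    refine Filter.Eventually.of_forall fun t ht => ?_
    have htI : t ∈ Icc (0 : ℝ) 1 := ⟨hx.1.trans ht.1.le, ht.2.trans hy.2⟩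
    have e : ‖m t * (q t * (2 * r t))‖ = (|m t| * (2 * |r t|)) * |q t| := by
      rw [Real.norm_eq_abs, abs_mul, abs_mul, abs_mul, abs_two]
      ring
    rw [e]
    have := hm t htI
    have := hr t htI
    gcongr
  have h2 : ∫ t in x..y, B * (2 * R) * |q t| ≤ ∫ t in (0 : ℝ)..1, B * (2 * R) * |q t| := by
    refine intervalIntegral.integral_mono_interval hx.1 hxy hy.2
      (Filter.Eventually.of_forall fun t => by positivity) hqa
  rw [intervalIntegral.integral_const_mul (a := 0)] at h2
  have h3 : B * (2 * R) * ∫ t in (0 : ℝ)..1, |q t| ≤ B * (2 * R) * Q := by gcongr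
  calc _ ≤ _ := h1
    _ ≤ _ := h2
    _ ≤ _ := h3
    _ = _ := by ring

namespace IsEnergyTriple

/-- Increment of the energy `p + lam ω g`. The second term on the right has the sign of the
variation of `ω`. -/
lemma energy_sub (h : IsEnergyTriple ω q lam g r p) (hq : IntervalIntegrable q volume 0 1)
    (hω : IntervalIntegrable ω volume 0 1) {x y : ℝ} (hx : x ∈ Icc (0 : ℝ) 1)
    (hy : y ∈ Icc (0 : ℝ) 1) :
    (p y + lam * ω y * g y) - (p x + lam * ω x * g x) =
      (∫ t in x..y, 1 * (q t * (2 * r t))) +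
        lam * (ω y * g y - ω x * g x - ∫ t in x..y, ω t * (2 * r t)) := by
  have hc : ContinuousOn (fun t => 2 * r t) (Icc 0 1) := continuousOn_const.mul h.cont_r
  have h1 := (intervalIntegrable_mul_unit hq hc).mono_set (uIcc_subset_unit hx hy)
  have h2 := (intervalIntegrable_mul_unit hω hc).mono_set (uIcc_subset_unit hx hy)
  have h3 := h.integral_p x hx y hy
  have h4 : ∫ t in x..y, 2 * (q t - lam * ω t) * r t =
      (∫ t in x..y, q t * (2 * r t)) - lam * ∫ t in x..y, ω t * (2 * r t) := by
    rw [← intervalIntegral.integral_const_mul, ← intervalIntegral.integral_sub h1 (h2.const_mul _)]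
    congr 1 with t
    ring
  simp only [one_mul]
  linarith

/-- Increment of the rescaled energy `p / ω + lam g`. The second term on the right has the sign of
the variation of `ω⁻¹`, opposite to that in `energy_sub`. -/
lemma weighted_energy_sub (h : IsEnergyTriple ω q lam g r p)
    (hq : IntervalIntegrable (fun t => (ω t)⁻¹ * q t) volume 0 1)
    (hω : ∀ t ∈ Icc (0 : ℝ) 1, 0 < ω t) {x y : ℝ}
    (hx : x ∈ Icc (0 : ℝ) 1) (hy : y ∈ Icc (0 : ℝ) 1) :
    ((ω y)⁻¹ * p y + lam * g y) - ((ω x)⁻¹ * p x + lam * g x) =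
      (∫ t in x..y, (ω t)⁻¹ * (q t * (2 * r t))) +
        ((ω y)⁻¹ * p y - (ω x)⁻¹ * p x -
          ∫ t in x..y, (ω t)⁻¹ * (2 * (q t - lam * ω t) * r t)) := by
  have hc : ContinuousOn (fun t => 2 * r t) (Icc 0 1) := continuousOn_const.mul h.cont_r
  have h1 := (intervalIntegrable_mul_unit hq hc).mono_set (uIcc_subset_unit hx hy)
  have h2 : IntervalIntegrable (fun t => 2 * r t) volume x y :=
    (hc.mono (by
      have := uIcc_subset_unit hx hy
      rwa [uIcc_of_le zero_le_one] at this)).intervalIntegrable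
  have h4 : ∫ t in x..y, (ω t)⁻¹ * (2 * (q t - lam * ω t) * r t) =
      (∫ t in x..y, (ω t)⁻¹ * (q t * (2 * r t))) - lam * (g y - g x) := by
    rw [← h.integral_g x hx y hy, ← intervalIntegral.integral_const_mul,
      ← intervalIntegral.integral_sub (by simpa only [mul_assoc] using h1) (h2.const_mul _)]
    refine intervalIntegral.integral_congr fun t ht => ?_
    have := hω t (by
      have := uIcc_subset_unit hx hy ht
      rwa [uIcc_of_le zero_le_one] at this)
    field_simp
  linarith

/-- The endpoint `e` where `ω` is largest controls both energies: up to an error coming from `q`,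
`p + lam ω g` is maximal and `p / ω + lam g` is minimal there. -/
theorem exists_endpoint (h : IsEnergyTriple ω q lam g r p)
    (hω : MonotoneOn ω (Icc 0 1) ∨ AntitoneOn ω (Icc 0 1)) {ω₀ R Q : ℝ} (hω₀ : 0 < ω₀)
    (hlow : ∀ x ∈ Icc (0 : ℝ) 1, ω₀ ≤ ω x) (hlam : 0 ≤ lam)
    (hq : IntervalIntegrable q volume 0 1) (hQ : ∫ t in (0 : ℝ)..1, |q t| ≤ Q)
    (hR : 0 ≤ R) (hr : ∀ t ∈ Icc (0 : ℝ) 1, |r t| ≤ R) :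
    ∃ e ∈ Icc (0 : ℝ) 1, ∀ y ∈ Icc (0 : ℝ) 1,
      p y + lam * ω y * g y ≤ p e + lam * ω e * g e + 2 * Q * R ∧
      (ω e)⁻¹ * p e + lam * g e ≤ (ω y)⁻¹ * p y + lam * g y + 2 * Q * R / ω₀ := by
  have hpos : ∀ t ∈ Icc (0 : ℝ) 1, 0 < ω t := fun t ht => hω₀.trans_le (hlow t ht)
  have hc : ContinuousOn (fun t => 2 * r t) (Icc 0 1) := continuousOn_const.mul h.cont_r
  have hci := hc.intervalIntegrable_of_Icc (μ := volume) zero_le_one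
  have hinv : ∀ t ∈ Icc (0 : ℝ) 1, |(ω t)⁻¹| ≤ ω₀⁻¹ := fun t ht => by
    rw [abs_of_pos (inv_pos.2 (hpos t ht))]
    exact inv_anti₀ hω₀ (hlow t ht)
  have hone : ∀ t ∈ Icc (0 : ℝ) 1, |(fun _ : ℝ => (1 : ℝ)) t| ≤ 1 := fun t _ => by simp
  have hsub : ∀ {x y : ℝ}, x ∈ Icc (0 : ℝ) 1 → y ∈ Icc (0 : ℝ) 1 → Icc x y ⊆ Icc (0 : ℝ) 1 :=
    fun hx hy => Icc_subset_Icc hx.1 hy.2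
  have e1 : 2 * ω₀⁻¹ * Q * R = 2 * Q * R / ω₀ := by field_simp
  have hωi := intervalIntegrable_weight hω
  have hp'i : IntervalIntegrable (fun t => 2 * (q t - lam * ω t) * r t) volume 0 1 :=
    (intervalIntegrable_mul_unit (hq.sub (hωi.const_mul lam)) hc).congr
      (fun t _ => by ring)
  rcases hω with hω | hω
  · have hinvm : AntitoneOn (fun t => (ω t)⁻¹) (Icc 0 1) := fun x hx y hy hxy =>
      inv_anti₀ (hpos x hx) (hω hx hy hxy)
    have hqi : IntervalIntegrable (fun t => (ω t)⁻¹ * q t) volume 0 1 := by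
      have := intervalIntegrable_mul_of_monotoneOn zero_le_one hinvm.neg hq
      exact this.neg.congr fun t _ => by simp
    refine ⟨1, right_mem_Icc.2 zero_le_one, fun y hy => ?_⟩
    have h1 : (1 : ℝ) ∈ Icc (0 : ℝ) 1 := right_mem_Icc.2 zero_le_one
    have hs := hsub hy h1
    have hu := uIcc_subset_unit hy h1
    constructor
    · have a1 := h.energy_sub hq hωi hy h1
      have a2 := integral_mul_deriv_le_of_monotoneOn hy.2 (hω.mono hs)
        (fun x hx => h.g_nonneg x (hs hx)) (hci.mono_set hu)
        (fun x hx y hy => h.integral_g x (hs hx) y (hs hy))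
      have a3 := abs_le.1 (abs_integral_potential_le zero_le_one hR hq hQ hone hr hy h1 hy.2)
      nlinarith [mul_nonneg hlam (sub_nonneg.2 a2)]
    · have a1 := h.weighted_energy_sub hqi hpos hy h1
      have a2 := le_integral_mul_deriv_of_antitoneOn hy.2 (hinvm.mono hs)
        (fun x hx => h.p_nonneg x (hs hx)) (hp'i.mono_set hu)
        (fun x hx y hy => h.integral_p x (hs hx) y (hs hy))
      have a3 := abs_le.1 (abs_integral_potential_le (inv_nonneg.2 hω₀.le) hR hq hQ hinv hr hy h1
        hy.2)
      rw [e1] at a3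
      linarith
  · have hinvm : MonotoneOn (fun t => (ω t)⁻¹) (Icc 0 1) := fun x hx y hy hxy =>
      inv_anti₀ (hpos y hy) (hω hx hy hxy)
    have hqi := intervalIntegrable_mul_of_monotoneOn zero_le_one hinvm hq
    refine ⟨0, left_mem_Icc.2 zero_le_one, fun y hy => ?_⟩
    have h0 : (0 : ℝ) ∈ Icc (0 : ℝ) 1 := left_mem_Icc.2 zero_le_one
    have hs := hsub h0 hy
    have hu := uIcc_subset_unit h0 hy
    constructor
    · have a1 := h.energy_sub hq hωi h0 hy
      have a2 := le_integral_mul_deriv_of_antitoneOn hy.1 (hω.mono hs)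
        (fun x hx => h.g_nonneg x (hs hx)) (hci.mono_set hu)
        (fun x hx y hy => h.integral_g x (hs hx) y (hs hy))
      have a3 := abs_le.1 (abs_integral_potential_le zero_le_one hR hq hQ hone hr h0 hy hy.1)
      nlinarith [mul_nonneg hlam (sub_nonneg.2 a2)]
    · have a1 := h.weighted_energy_sub hqi hpos h0 hy
      have a2 := integral_mul_deriv_le_of_monotoneOn hy.1 (hinvm.mono hs)
        (fun x hx => h.p_nonneg x (hs hx)) (hp'i.mono_set hu)
        (fun x hx y hy => h.integral_p x (hs hx) y (hs hy))
      have a3 := abs_le.1 (abs_integral_potential_le (inv_nonneg.2 hω₀.le) hR hq hQ hinv hr h0 hy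
        hy.1)
      rw [e1] at a3
      linarith

/-- The energy identity `∫ p + ∫ q g - lam = r 1 - r 0`, read as an upper bound of `∫ |y'|²`. -/
lemma integral_p_le (h : IsEnergyTriple ω q lam g r p)
    (hωi : IntervalIntegrable ω volume 0 1) {c T Q : ℝ}
    (hq : IntervalIntegrable q volume 0 1) (hQ : ∫ t in (0 : ℝ)..1, |q t| ≤ Q)
    (hnorm : ∫ t in (0 : ℝ)..1, ω t * g t = 1) (hT : ∀ x ∈ Icc (0 : ℝ) 1, g x ≤ T)
    (hbd : r 1 - r 0 ≤ c * T) :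
    ∫ t in (0 : ℝ)..1, p t ≤ lam + (c + Q) * T := by
  have hpi := h.cont_p.intervalIntegrable_of_Icc (μ := volume) zero_le_one
  have hqg := intervalIntegrable_mul_unit hq h.cont_g
  have hωg := intervalIntegrable_mul_unit hωi h.cont_g
  have e : ∫ t in (0 : ℝ)..1, (p t + (q t - lam * ω t) * g t) =
      (∫ t in (0 : ℝ)..1, p t) + (∫ t in (0 : ℝ)..1, q t * g t) - lam := by
    have e1 : lam = ∫ t in (0 : ℝ)..1, lam * (ω t * g t) := by
      rw [intervalIntegral.integral_const_mul, hnorm, mul_one]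
    conv_rhs => rw [e1]
    rw [← intervalIntegral.integral_add hpi hqg,
      ← intervalIntegral.integral_sub (hpi.add hqg) (hωg.const_mul _)]
    congr 1 with t
    ring
  have hT0 : 0 ≤ T := (h.g_nonneg 0 (by simp)).trans (hT 0 (by simp))
  have hlow : -(Q * T) ≤ ∫ t in (0 : ℝ)..1, q t * g t := by
    have h1 : ∫ t in (0 : ℝ)..1, -(T * |q t|) ≤ ∫ t in (0 : ℝ)..1, q t * g t := by
      refine intervalIntegral.integral_mono_on zero_le_one (hq.abs.const_mul T).neg hqg
        fun t ht => ?_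
      have h1 := neg_abs_le (q t)
      have h2 := h.g_nonneg t ht
      have h3 := hT t ht
      nlinarith [abs_nonneg (q t)]
    rw [intervalIntegral.integral_neg, intervalIntegral.integral_const_mul] at h1
    nlinarith
  have := h.integral_r
  linarith

/-- For large `lam` the energy is at most a constant times its mean, which is of order `lam`; as the
energy dominates `lam ω₀ g`, this bounds `g` independently of `lam`. -/
lemma le_of_large (h : IsEnergyTriple ω q lam g r p)
    (hω : MonotoneOn ω (Icc 0 1) ∨ AntitoneOn ω (Icc 0 1)) {ω₀ ω₁ c Q : ℝ} (hω₀ : 0 < ω₀)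
    (hlow : ∀ x ∈ Icc (0 : ℝ) 1, ω₀ ≤ ω x) (hup : ∀ x ∈ Icc (0 : ℝ) 1, ω x ≤ ω₁)
    (hq : IntervalIntegrable q volume 0 1) (hQ : ∫ t in (0 : ℝ)..1, |q t| ≤ Q)
    (hnorm : ∫ t in (0 : ℝ)..1, ω t * g t = 1) (hc : 0 ≤ c)
    (hbd : ∀ T, (∀ x ∈ Icc (0 : ℝ) 1, g x ≤ T) → r 1 - r 0 ≤ c * T)
    (hlam : 0 < lam)
    (hlam1 : 4 * (ω₁ / ω₀) * (c + Q) ≤ lam * ω₀)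
    (hlam2 : 4 * (ω₁ / ω₀ + 1) * Q ≤ Real.sqrt (lam * ω₀)) :
    ∀ x ∈ Icc (0 : ℝ) 1, g x ≤ 4 * (ω₁ / ω₀) / ω₀ := by
  have h0 : (0 : ℝ) ∈ Icc (0 : ℝ) 1 := by simp
  have hQ0 : 0 ≤ Q := (intervalIntegral.integral_nonneg zero_le_one fun t _ => abs_nonneg _).trans hQ
  have hω₁ : 0 < ω₁ := hω₀.trans_le ((hlow 0 h0).trans (hup 0 h0))
  have hωi := intervalIntegrable_weight hω
  have hpi := h.cont_p.intervalIntegrable_of_Icc (μ := volume) zero_le_one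
  have hωg := intervalIntegrable_mul_unit hωi h.cont_g
  obtain ⟨xT, hxT, hmaxT⟩ := isCompact_Icc.exists_isMaxOn ⟨0, h0⟩ h.cont_g
  obtain ⟨xR, hxR, hmaxR⟩ := isCompact_Icc.exists_isMaxOn ⟨0, h0⟩ h.cont_r.abs
  set T := g xT with hTdef
  set R := |r xR| with hRdef
  have hT : ∀ x ∈ Icc (0 : ℝ) 1, g x ≤ T := fun x hx => hmaxT hx
  have hr : ∀ x ∈ Icc (0 : ℝ) 1, |r x| ≤ R := fun x hx => hmaxR hx
  have hR0 : 0 ≤ R := abs_nonneg _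
  have hT0 : 0 ≤ T := h.g_nonneg _ hxT
  obtain ⟨e, he, hE⟩ := h.exists_endpoint hω hω₀ hlow hlam.le hq hQ hR0 hr
  have hp := h.integral_p_le hωi hq hQ hnorm hT (hbd T hT)
  set s := Real.sqrt (lam * ω₀) with hs
  have hlω : 0 < lam * ω₀ := mul_pos hlam hω₀
  have hs0 : 0 < s := Real.sqrt_pos.2 hlω
  have hss : s * s = lam * ω₀ := Real.mul_self_sqrt hlω.le
  set X := p e + lam * ω e * g e + 2 * Q * R with hX
  -- The weighted energy at `e` is at most its average plus the error.
  have hG : (ω e)⁻¹ * p e + lam * g e ≤ (2 * lam + (c + Q) * T) / ω₀ + 2 * Q * R / ω₀ := by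
    have h1 : ∫ t in (0 : ℝ)..1, ((ω e)⁻¹ * p e + lam * g e) ≤
        ∫ t in (0 : ℝ)..1, (ω₀⁻¹ * (p t + lam * (ω t * g t)) + 2 * Q * R / ω₀) := by
      refine intervalIntegral.integral_mono_on zero_le_one (by simp)
        (((hpi.add (hωg.const_mul lam)).const_mul _).add (by simp)) fun t ht => ?_
      refine ((hE t ht).2).trans ?_
      have hωt : 0 < ω t := hω₀.trans_le (hlow t ht)
      have e1 : (ω t)⁻¹ * p t + lam * g t = (ω t)⁻¹ * (p t + lam * (ω t * g t)) := by
        field_simp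
      have h2 : 0 ≤ p t + lam * (ω t * g t) :=
        add_nonneg (h.p_nonneg t ht) (mul_nonneg hlam.le (mul_nonneg hωt.le (h.g_nonneg t ht)))
      rw [e1]
      have := mul_le_mul_of_nonneg_right (inv_anti₀ hω₀ (hlow t ht)) h2
      linarith
    rw [intervalIntegral.integral_add ((hpi.add (hωg.const_mul lam)).const_mul _) (by simp),
      intervalIntegral.integral_const_mul,
      intervalIntegral.integral_add hpi (hωg.const_mul lam), intervalIntegral.integral_const_mul,
      hnorm] at h1
    simp only [intervalIntegral.integral_const, sub_zero, one_smul] at h1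
    refine h1.trans ?_
    rw [div_eq_inv_mul (2 * lam + (c + Q) * T)]
    have : ω₀⁻¹ * ((∫ t in (0 : ℝ)..1, p t) + lam * 1) ≤ ω₀⁻¹ * (2 * lam + (c + Q) * T) :=
      mul_le_mul_of_nonneg_left (by linarith) (inv_nonneg.2 hω₀.le)
    linarith
  have hωe : 0 < ω e := hω₀.trans_le (hlow e he)
  have hEe : p e + lam * ω e * g e ≤ ω₁ / ω₀ * (2 * lam + (c + Q) * T + 2 * Q * R) := by
    have e1 : p e + lam * ω e * g e = ω e * ((ω e)⁻¹ * p e + lam * g e) := by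
      field_simp
    have h2 : 0 ≤ (ω e)⁻¹ * p e + lam * g e :=
      add_nonneg (mul_nonneg (inv_nonneg.2 hωe.le) (h.p_nonneg e he))
        (mul_nonneg hlam.le (h.g_nonneg e he))
    calc p e + lam * ω e * g e = ω e * ((ω e)⁻¹ * p e + lam * g e) := e1
      _ ≤ ω₁ * ((ω e)⁻¹ * p e + lam * g e) := mul_le_mul_of_nonneg_right (hup e he) h2
      _ ≤ ω₁ * ((2 * lam + (c + Q) * T) / ω₀ + 2 * Q * R / ω₀) :=
        mul_le_mul_of_nonneg_left hG hω₁.le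
      _ = _ := by field_simp
  -- The energy dominates `lam * ω₀ * g` and, by the arithmetic-geometric mean, `2 * s * |r|`.
  have hTX : lam * ω₀ * T ≤ X := by
    refine le_trans ?_ (hE xT hxT).1
    have := mul_le_mul_of_nonneg_right (mul_le_mul_of_nonneg_left (hlow xT hxT) hlam.le) hT0
    have := h.p_nonneg xT hxT
    linarith
  have hRX : 2 * s * R ≤ X := by
    refine le_trans ?_ (hE xR hxR).1
    have hg := h.g_nonneg xR hxR
    have hp0 := h.p_nonneg xR hxR
    have h1 : lam * ω₀ * g xR ≤ lam * ω xR * g xR :=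
      mul_le_mul_of_nonneg_right (mul_le_mul_of_nonneg_left (hlow xR hxR) hlam.le) hg
    refine le_trans ?_ (add_le_add_right h1 (p xR))
    refine abs_le_of_sq_le_sq' ?_ (by positivity) |>.2
    have h2 := h.sq_le xR hxR
    have h3 : (2 * s * R) ^ 2 = 4 * (lam * ω₀) * r xR ^ 2 := by
      rw [hRdef, mul_pow, sq_abs, ← hss]
      ring
    rw [h3]
    nlinarith [sq_nonneg (p xR - lam * ω₀ * g xR), mul_le_mul_of_nonneg_left h2 hlω.le]
  set κ := ω₁ / ω₀ with hκ
  have hκ0 : 0 < κ := div_pos hω₁ hω₀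
  have hX1 : κ * (c + Q) * T ≤ X / 4 := by
    have := mul_le_mul_of_nonneg_right hlam1 hT0
    linarith
  have hX2 : (κ + 1) * (2 * Q * R) ≤ X / 4 := by
    have := mul_le_mul_of_nonneg_right hlam2 (by positivity : 0 ≤ 2 * R)
    linarith
  have hX3 : X ≤ 4 * κ * lam := by
    have : X ≤ κ * (2 * lam + (c + Q) * T + 2 * Q * R) + 2 * Q * R := by linarith
    nlinarith
  intro x hx
  refine (hT x hx).trans ?_
  rw [le_div_iff₀ hω₀]
  refine le_of_mul_le_mul_left ?_ hlam
  linarith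

/-- For `lam ≤ Λ`, however negative, `∫ |y'|²` is bounded up to a multiple of `max g`, which a
one-dimensional Sobolev inequality absorbs. -/
lemma le_of_small (h : IsEnergyTriple ω q lam g r p)
    (hωi : IntervalIntegrable ω volume 0 1) {ω₀ c Q Λ : ℝ} (hω₀ : 0 < ω₀)
    (hlow : ∀ x ∈ Icc (0 : ℝ) 1, ω₀ ≤ ω x)
    (hq : IntervalIntegrable q volume 0 1) (hQ : ∫ t in (0 : ℝ)..1, |q t| ≤ Q)
    (hnorm : ∫ t in (0 : ℝ)..1, ω t * g t = 1) (hc : 0 ≤ c)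
    (hbd : ∀ T, (∀ x ∈ Icc (0 : ℝ) 1, g x ≤ T) → r 1 - r 0 ≤ c * T)
    (hlam : lam ≤ Λ) :
    ∀ x ∈ Icc (0 : ℝ) 1,
      g x ≤ 2 * ((1 + 2 * (c + Q + 1)) / ω₀ + Λ / (2 * (c + Q + 1))) := by
  have h0 : (0 : ℝ) ∈ Icc (0 : ℝ) 1 := by simp
  have hQ0 : 0 ≤ Q := (intervalIntegral.integral_nonneg zero_le_one fun t _ => abs_nonneg _).trans hQ
  have hpi := h.cont_p.intervalIntegrable_of_Icc (μ := volume) zero_le_one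
  have hgi := h.cont_g.intervalIntegrable_of_Icc (μ := volume) zero_le_one
  have hri := h.cont_r.intervalIntegrable_of_Icc (μ := volume) zero_le_one
  obtain ⟨xT, hxT, hmaxT⟩ := isCompact_Icc.exists_isMaxOn ⟨0, h0⟩ h.cont_g
  set T := g xT with hTdef
  have hT : ∀ x ∈ Icc (0 : ℝ) 1, g x ≤ T := fun x hx => hmaxT hx
  have hT0 : 0 ≤ T := h.g_nonneg _ hxT
  have hp := h.integral_p_le hωi hq hQ hnorm hT (hbd T hT)
  have hg : ∫ t in (0 : ℝ)..1, g t ≤ ω₀⁻¹ := by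
    have h1 : ∫ t in (0 : ℝ)..1, ω₀ * g t ≤ ∫ t in (0 : ℝ)..1, ω t * g t :=
      intervalIntegral.integral_mono_on zero_le_one (hgi.const_mul _)
        (intervalIntegrable_mul_unit hωi h.cont_g) fun t ht =>
        mul_le_mul_of_nonneg_right (hlow t ht) (h.g_nonneg t ht)
    rw [intervalIntegral.integral_const_mul, hnorm] at h1
    rw [inv_eq_one_div, le_div_iff₀ hω₀]
    linarith
  -- With this `N` the term `N⁻¹ * (c + Q) * T` is at most `T / 2`.
  set N := 2 * (c + Q + 1) with hN
  have hN0 : 0 < N := by positivity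
  have hR : ∫ t in (0 : ℝ)..1, |2 * r t| ≤
      N * (∫ t in (0 : ℝ)..1, g t) + N⁻¹ * ∫ t in (0 : ℝ)..1, p t := by
    rw [← intervalIntegral.integral_const_mul, ← intervalIntegral.integral_const_mul,
      ← intervalIntegral.integral_add (hgi.const_mul _) (hpi.const_mul _)]
    refine intervalIntegral.integral_mono_on zero_le_one (hri.const_mul 2).abs
      ((hgi.const_mul _).add (hpi.const_mul _)) fun t ht => ?_
    have hg := h.g_nonneg t ht
    have hp0 := h.p_nonneg t ht
    refine abs_le_of_sq_le_sq ?_ (by positivity)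
    have h2 := h.sq_le t ht
    have h3 : N * N⁻¹ = 1 := mul_inv_cancel₀ hN0.ne'
    have h4 : (N * g t + N⁻¹ * p t) ^ 2 =
        (N * g t - N⁻¹ * p t) ^ 2 + 4 * (N * N⁻¹) * (g t * p t) := by ring
    rw [h4, h3]
    nlinarith [sq_nonneg (N * g t - N⁻¹ * p t)]
  have hTg : T ≤ (∫ t in (0 : ℝ)..1, g t) + ∫ t in (0 : ℝ)..1, |2 * r t| := by
    have h1 : ∫ t in (0 : ℝ)..1, T ≤
        ∫ t in (0 : ℝ)..1, (g t + ∫ u in (0 : ℝ)..1, |2 * r u|) := by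
      refine intervalIntegral.integral_mono_on zero_le_one (by simp) (hgi.add (by simp))
        fun t ht => ?_
      have h2 := h.integral_g t ht xT hxT
      have h3 : |∫ u in t..xT, 2 * r u| ≤ ∫ u in (0 : ℝ)..1, |2 * r u| := by
        rw [← Real.norm_eq_abs]
        refine (intervalIntegral.norm_integral_le_integral_norm_uIoc).trans ?_
        rw [intervalIntegral.integral_of_le zero_le_one]
        refine setIntegral_mono_set ?_ ?_ ?_
        · exact (hri.const_mul 2).abs.1
        · exact Filter.Eventually.of_forall fun _ => abs_nonneg _
        · refine LE.le.eventuallyLE ?_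
          exact Ioc_subset_Ioc (le_min ht.1 hxT.1) (max_le ht.2 hxT.2)
      have := (le_abs_self _).trans h3
      linarith
    rw [intervalIntegral.integral_add hgi (by simp)] at h1
    simpa using h1
  intro x hx
  refine (hT x hx).trans ?_
  have k1 : N⁻¹ * ∫ t in (0 : ℝ)..1, p t ≤ Λ / N + T / 2 := by
    have : N⁻¹ * ∫ t in (0 : ℝ)..1, p t ≤ N⁻¹ * (Λ + N / 2 * T) := by
      refine mul_le_mul_of_nonneg_left ?_ (inv_nonneg.2 hN0.le)
      rw [hN]
      nlinarith
    refine this.trans (le_of_eq ?_)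
    field_simp
  have k2 : (1 + N) * ∫ t in (0 : ℝ)..1, g t ≤ (1 + N) * ω₀⁻¹ :=
    mul_le_mul_of_nonneg_left hg (by positivity)
  rw [div_eq_mul_inv (1 + N)]
  linarith

end IsEnergyTriple

/-- The uniform bound in real form, with constants depending only on `ω`, `c` and `Q`. -/
theorem exists_bound_energyTriple {ω : ℝ → ℝ}
    (hω : MonotoneOn ω (Icc 0 1) ∨ AntitoneOn ω (Icc 0 1)) {ω₀ : ℝ} (hω₀ : 0 < ω₀)
    (hlow : ∀ x ∈ Icc (0 : ℝ) 1, ω₀ ≤ ω x) {c Q : ℝ} (hc : 0 ≤ c) (hQ0 : 0 ≤ Q) :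
    ∃ M : ℝ, ∀ (q : ℝ → ℝ) (lam : ℝ) (g r p : ℝ → ℝ), IsEnergyTriple ω q lam g r p →
      IntervalIntegrable q volume 0 1 → ∫ t in (0 : ℝ)..1, |q t| ≤ Q →
      ∫ t in (0 : ℝ)..1, ω t * g t = 1 →
      (∀ T, (∀ x ∈ Icc (0 : ℝ) 1, g x ≤ T) → r 1 - r 0 ≤ c * T) →
      ∀ x ∈ Icc (0 : ℝ) 1, g x ≤ M := by
  have h0 : (0 : ℝ) ∈ Icc (0 : ℝ) 1 := by simp
  have h1 : (1 : ℝ) ∈ Icc (0 : ℝ) 1 := by simp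
  obtain ⟨ω₁, hup⟩ : ∃ ω₁, ∀ x ∈ Icc (0 : ℝ) 1, ω x ≤ ω₁ := by
    rcases hω with hω | hω
    · exact ⟨ω 1, fun x hx => hω hx h1 hx.2⟩
    · exact ⟨ω 0, fun x hx => hω h0 hx hx.1⟩
  have hωi := intervalIntegrable_weight hω
  have hω₁ : 0 < ω₁ := hω₀.trans_le ((hlow 0 h0).trans (hup 0 h0))
  set κ := ω₁ / ω₀ with hκ
  have hκ0 : 0 < κ := div_pos hω₁ hω₀
  -- Beyond `Λ` both smallness conditions of `le_of_large` hold; the `1` keeps `Λ` positive.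
  set Λ := (1 + 4 * κ * (c + Q) + (4 * (κ + 1) * Q) ^ 2) / ω₀ with hΛ
  have hΛω : Λ * ω₀ = 1 + 4 * κ * (c + Q) + (4 * (κ + 1) * Q) ^ 2 := by
    rw [hΛ]
    field_simp
  have hΛ0 : 0 < Λ := by positivity
  refine ⟨max (4 * κ / ω₀) (2 * ((1 + 2 * (c + Q + 1)) / ω₀ + Λ / (2 * (c + Q + 1)))),
    fun q lam g r p h hq hQ hnorm hbd x hx => ?_⟩
  rcases le_total lam Λ with hl | hl
  · exact (h.le_of_small hωi hω₀ hlow hq hQ hnorm hc hbd hl x hx).trans (le_max_right _ _)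
  · have hle : Λ * ω₀ ≤ lam * ω₀ := mul_le_mul_of_nonneg_right hl hω₀.le
    have hp1 : 0 ≤ 4 * κ * (c + Q) := by positivity
    refine (h.le_of_large hω hω₀ hlow hup hq hQ hnorm hc hbd (hΛ0.trans_le hl) ?_ ?_ x hx).trans
      (le_max_left _ _)
    · nlinarith [sq_nonneg (4 * (κ + 1) * Q)]
    · refine Real.le_sqrt_of_sq_le ?_
      linarith


/-! ### Solutions and eigenfunctions -/

lemma _root_.AbsolutelyContinuousOnInterval.conj_mul {f h : ℝ → ℂ} {a b : ℝ}
    (hf : AbsolutelyContinuousOnInterval f a b) (hh : AbsolutelyContinuousOnInterval h a b) :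
    AbsolutelyContinuousOnInterval (fun x => starRingEnd ℂ (f x) * h x) a b :=
  (hf.comp_lipschitz Complex.isometry_conj.lipschitz).fun_smul hh

/-- The fundamental theorem of calculus for the product `f̄ h` of absolutely continuous functions,
followed by a real-linear functional so that both real and imaginary parts are covered. -/
lemma integral_clm_conj_mul {f f' h h' : ℝ → ℂ} (L : ℂ →L[ℝ] ℝ)
    (hf : AbsolutelyContinuousOnInterval f 0 1) (hh : AbsolutelyContinuousOnInterval h 0 1)
    (hf' : ∀ᵐ x, x ∈ uIcc (0 : ℝ) 1 → HasDerivAt f (f' x) x)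
    (hh' : ∀ᵐ x, x ∈ uIcc (0 : ℝ) 1 → HasDerivAt h (h' x) x) {x y : ℝ}
    (hx : x ∈ Icc (0 : ℝ) 1) (hy : y ∈ Icc (0 : ℝ) 1) :
    ∫ t in x..y, L (starRingEnd ℂ (f' t) * h t + starRingEnd ℂ (f t) * h' t) =
      L (starRingEnd ℂ (f y) * h y) - L (starRingEnd ℂ (f x) * h x) := by
  have hac := ((hf.conj_mul hh).comp_lipschitz L.lipschitz).mono (uIcc_subset_unit hx hy)
  refine hac.integral_eq_sub_of_ae_hasDerivAt ?_
  filter_upwards [hf', hh'] with t h1 h2 ht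
  have ht' := uIcc_subset_unit hx hy ht
  have h3 : HasDerivAt (fun s => starRingEnd ℂ (f s)) (starRingEnd ℂ (f' t)) t :=
    Complex.conjCLE.toContinuousLinearMap.hasFDerivAt.comp_hasDerivAt t (h1 ht')
  exact L.hasFDerivAt.comp_hasDerivAt t (h3.mul (h2 ht'))

namespace IsSolution

variable {ω q : ℝ → ℝ} {lam : ℂ} {φ : ℝ → ℂ}

lemma hasDerivWithinAt (h : IsSolution ω q lam φ) {x : ℝ} (hx : x ∈ Icc (0 : ℝ) 1) :
    HasDerivWithinAt φ (D φ x) (Icc 0 1) x :=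
  (h.differentiableOn x hx).hasDerivWithinAt

lemma continuousOn_D (h : IsSolution ω q lam φ) : ContinuousOn (D φ) (Icc 0 1) := by
  simpa [uIcc_of_le zero_le_one] using h.absolutelyContinuous.continuousOn

lemma absolutelyContinuous_self (h : IsSolution ω q lam φ) :
    AbsolutelyContinuousOnInterval φ 0 1 :=
  .of_hasDerivWithinAt zero_le_one (fun _ hx => h.hasDerivWithinAt hx) h.continuousOn_D

lemma ae_hasDerivAt (h : IsSolution ω q lam φ) :
    ∀ᵐ x, x ∈ uIcc (0 : ℝ) 1 → HasDerivAt φ (D φ x) x ∧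
      HasDerivAt (D φ) (((q x : ℂ) - lam * ω x) * φ x) x := by
  have h0 : ∀ᵐ x : ℝ, x ≠ 0 := by simp [ae_iff]
  have h1 : ∀ᵐ x : ℝ, x ≠ 1 := by simp [ae_iff]
  filter_upwards [h0, h1, h.absolutelyContinuous.ae_differentiableAt_complex,
    (ae_restrict_iff' measurableSet_Icc).1 h.equation] with x hx0 hx1 hd he hx
  have hI := hx
  rw [uIcc_of_le zero_le_one] at hI
  have hn : Icc (0 : ℝ) 1 ∈ nhds x :=
    Icc_mem_nhds (lt_of_le_of_ne hI.1 hx0.symm) (lt_of_le_of_ne hI.2 hx1)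
  refine ⟨(h.hasDerivWithinAt hI).hasDerivAt hn, ?_⟩
  have e : D (D φ) x = deriv (D φ) x := derivWithin_of_mem_nhds hn
  have e2 : ((q x : ℂ) - lam * ω x) * φ x = deriv (D φ) x := by
    rw [← e]
    linear_combination he hI
  rw [e2]
  exact (hd hx).hasDerivAt

/-- The energy identity, `(ȳ y')' = |y'|² + (q - lam ω) |y|²`, integrated over `[0,1]`; `lam` may
still be complex. -/
lemma integral_conj_mul_D (h : IsSolution ω q lam φ) (L : ℂ →L[ℝ] ℝ) :
    ∫ t in (0 : ℝ)..1, L ((Complex.normSq (D φ t) : ℂ) +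
        ((q t : ℂ) - lam * ω t) * Complex.normSq (φ t)) =
      L (starRingEnd ℂ (φ 1) * D φ 1) - L (starRingEnd ℂ (φ 0) * D φ 0) := by
  rw [← integral_clm_conj_mul L h.absolutelyContinuous_self h.absolutelyContinuous
    (h.ae_hasDerivAt.mono fun x hx hI => (hx hI).1) (h.ae_hasDerivAt.mono fun x hx hI => (hx hI).2)
    (x := 0) (y := 1) (by simp) (by simp)]
  congr 1 with t
  rw [Complex.normSq_eq_conj_mul_self, Complex.normSq_eq_conj_mul_self]
  congr 1
  ring

theorem isEnergyTriple {lam : ℝ} (h : IsSolution ω q lam φ) :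
    IsEnergyTriple ω q lam (fun x => Complex.normSq (φ x))
      (fun x => (starRingEnd ℂ (φ x) * D φ x).re) (fun x => Complex.normSq (D φ x)) := by
  have hφ := h.absolutelyContinuous_self
  have hv := h.absolutelyContinuous
  have hφ' := h.ae_hasDerivAt.mono fun x hx hI => (hx hI).1
  have hv' := h.ae_hasDerivAt.mono fun x hx hI => (hx hI).2
  have hcφ : ContinuousOn φ (Icc 0 1) := h.differentiableOn.continuousOn
  have hcv := h.continuousOn_D
  refine
    { g_nonneg := fun x _ => Complex.normSq_nonneg _
      p_nonneg := fun x _ => Complex.normSq_nonneg _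
      sq_le := fun x _ => ?_
      cont_g := Complex.continuous_normSq.comp_continuousOn hcφ
      cont_r := Complex.continuous_re.comp_continuousOn
        ((Complex.continuous_conj.comp_continuousOn hcφ).mul hcv)
      cont_p := Complex.continuous_normSq.comp_continuousOn hcv
      integral_g := fun x hx y hy => ?_
      integral_p := fun x hx y hy => ?_
      integral_r := ?_ }
  · have := Complex.re_sq_le_normSq (starRingEnd ℂ (φ x) * D φ x)
    rw [Complex.normSq_mul, Complex.normSq_conj] at this
    rwa [sq]
  · have := integral_clm_conj_mul Complex.reCLM hφ hφ hφ' hφ' hx hy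
    simp only [Complex.reCLM_apply, ← Complex.normSq_eq_conj_mul_self, Complex.ofReal_re] at this
    rw [← this]
    congr 1 with t
    simp only [Complex.add_re, Complex.mul_re, Complex.conj_re, Complex.conj_im]
    ring
  · have := integral_clm_conj_mul Complex.reCLM hv hv hv' hv' hx hy
    simp only [Complex.reCLM_apply, ← Complex.normSq_eq_conj_mul_self, Complex.ofReal_re] at this
    rw [← this]
    congr 1 with t
    simp only [← Complex.ofReal_mul, ← Complex.ofReal_sub, map_mul, Complex.conj_ofReal,
      Complex.add_re, Complex.mul_re, Complex.conj_re, Complex.conj_im, Complex.ofReal_re,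
      Complex.ofReal_im, Complex.mul_im]
    ring
  · have := h.integral_conj_mul_D Complex.reCLM
    simpa only [Complex.reCLM_apply, ← Complex.ofReal_mul, ← Complex.ofReal_sub,
      ← Complex.ofReal_add, Complex.ofReal_re] using this

end IsSolution

/-- A separated boundary condition makes `ȳ y'` a real multiple of `|y|²`. In the Dirichlet case
`sin θ = 0` the quotient is zero by convention, and both sides vanish since `y = 0`. -/
lemma conj_mul_eq_of_boundary {θ : ℝ} {y d : ℂ}
    (h : y * (Real.cos θ : ℂ) + d * (Real.sin θ : ℂ) = 0) :
    starRingEnd ℂ y * d = ((-(Real.cos θ / Real.sin θ) * Complex.normSq y : ℝ) : ℂ) := by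
  by_cases hs : Real.sin θ = 0
  · have hc : Real.cos θ ≠ 0 := fun hc => by
      have := Real.sin_sq_add_cos_sq θ
      rw [hs, hc] at this
      norm_num at this
    have hy : y = 0 := by
      rw [hs] at h
      simpa [-Complex.ofReal_cos, hc] using h
    simp [hy]
  · have hs' : (Real.sin θ : ℂ) ≠ 0 := by exact_mod_cast hs
    have hd : d = -((Real.cos θ : ℂ) / Real.sin θ) * y := by
      field_simp
      linear_combination h
    rw [hd, Complex.ofReal_mul, Complex.normSq_eq_conj_mul_self, Complex.ofReal_neg,
      Complex.ofReal_div]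
    ring

/-- Eigenvalues are real: in the energy identity the boundary terms, `|φ'|²` and `q |φ|²` are real,
so its imaginary part reads `lam.im * ∫ ω |φ|² = 0`. -/
theorem IsEigenfunction.im_eq_zero {α β : ℝ} {ω q : ℝ → ℝ} {lam : ℂ} {φ : ℝ → ℂ}
    (h : IsEigenfunction α β ω q lam φ)
    (hnorm : ∫ t in (0 : ℝ)..1, ω t * Complex.normSq (φ t) = 1) : lam.im = 0 := by
  have h1 := h.solution.integral_conj_mul_D Complex.imCLM
  rw [conj_mul_eq_of_boundary h.boundary_zero, conj_mul_eq_of_boundary h.boundary_one] at h1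
  simp only [Complex.imCLM_apply, Complex.ofReal_im, sub_zero] at h1
  have h2 : ∫ t in (0 : ℝ)..1, ((Complex.normSq (D φ t) : ℂ) +
      ((q t : ℂ) - lam * ω t) * Complex.normSq (φ t)).im =
      ∫ t in (0 : ℝ)..1, -lam.im * (ω t * Complex.normSq (φ t)) := by
    congr 1 with t
    simp only [Complex.add_im, Complex.sub_im, Complex.mul_im, Complex.ofReal_im,
      Complex.ofReal_re]
    ring
  rw [h2, intervalIntegral.integral_const_mul, hnorm] at h1
  linarith

lemma L1.intervalIntegrable_coeFn (q : L1) : IntervalIntegrable q volume 0 1 :=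
  (intervalIntegrable_iff_integrableOn_Icc_of_le zero_le_one).2 (MeasureTheory.L1.integrable_coeFn q)

lemma L1.integral_abs_eq_norm (q : L1) : ∫ t in (0 : ℝ)..1, |q t| = ‖q‖ := by
  rw [MeasureTheory.L1.norm_eq_integral_norm, intervalIntegral.integral_of_le zero_le_one,
    ← integral_Icc_eq_integral_Ioc]
  rfl

lemma iInf_le_of_monotoneOn_or_antitoneOn {ω : ℝ → ℝ}
    (hω : MonotoneOn ω (Icc 0 1) ∨ AntitoneOn ω (Icc 0 1)) {x : ℝ} (hx : x ∈ Icc (0 : ℝ) 1) :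
    ⨅ t : Icc (0 : ℝ) 1, ω t ≤ ω x := by
  have h0 : (0 : ℝ) ∈ Icc (0 : ℝ) 1 := by simp
  have h1 : (1 : ℝ) ∈ Icc (0 : ℝ) 1 := by simp
  have hb : BddBelow (range fun t : Icc (0 : ℝ) 1 => ω t) := by
    rcases hω with hω | hω
    · exact ⟨ω 0, by rintro _ ⟨t, rfl⟩; exact hω h0 t.2 t.2.1⟩
    · exact ⟨ω 1, by rintro _ ⟨t, rfl⟩; exact hω t.2 h1 t.2.2⟩
  exact ciInf_le hb ⟨x, hx⟩

end SturmLiouville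

theorem proposition3p4 (α β : ℝ) (hα : α ∈ Set.Ico 0 Real.pi) (hβ : β ∈ Set.Ico 0 Real.pi)
    (ω : ℝ → ℝ)
    (H1 : MonotoneOn ω (Set.Icc 0 1) ∨ AntitoneOn ω (Set.Icc 0 1))
    (H2 : 0 < ⨅ x : Set.Icc (0 : ℝ) 1, ω x)
    (Ω : Set SturmLiouville.L1) (hΩ : Bornology.IsBounded Ω) :
    ∃ M : ℝ, 0 < M ∧
      ∀ q ∈ Ω, ∀ (lam : ℂ) (φ : ℝ → ℂ),
        SturmLiouville.IsNormalizedEigenfunction α β ω q lam φ →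
          ∀ x ∈ Set.Icc (0 : ℝ) 1, ‖φ x‖ ≤ M := by
  obtain ⟨Q, hQ0, hQ⟩ := hΩ.exists_pos_norm_le
  set a := Real.cos α / Real.sin α with ha
  set b := Real.cos β / Real.sin β with hb
  obtain ⟨M, hM⟩ := SturmLiouville.exists_bound_energyTriple H1 H2
    (fun x hx => SturmLiouville.iInf_le_of_monotoneOn_or_antitoneOn H1 hx)
    (c := |a| + |b|) (by positivity) hQ0.le
  refine ⟨Real.sqrt M + 1, by positivity, fun q hq lam φ hφ x hx => ?_⟩
  obtain ⟨hφ, hn⟩ := hφ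
  have hnorm : ∫ t in (0 : ℝ)..1, ω t * Complex.normSq (φ t) = 1 := by
    rw [SturmLiouville.weightedNorm, Real.sqrt_eq_one] at hn
    simpa only [Complex.normSq_eq_norm_sq] using hn
  obtain ⟨l, rfl⟩ : ∃ l : ℝ, lam = l :=
    ⟨lam.re, Complex.ext (by simp) (by simpa using hφ.im_eq_zero hnorm)⟩
  have hle := hM q l _ _ _ hφ.solution.isEnergyTriple
    (SturmLiouville.L1.intervalIntegrable_coeFn q)
    ((SturmLiouville.L1.integral_abs_eq_norm q).trans_le (hQ q hq)) hnorm (fun T hT => by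
      rw [SturmLiouville.conj_mul_eq_of_boundary hφ.boundary_zero,
        SturmLiouville.conj_mul_eq_of_boundary hφ.boundary_one, Complex.ofReal_re,
        Complex.ofReal_re]
      have h0 := hT 0 (by simp)
      have h1 := hT 1 (by simp)
      have k0 := mul_le_mul (le_abs_self a) h0 (Complex.normSq_nonneg _) (abs_nonneg a)
      have k1 := mul_le_mul (neg_le_abs b) h1 (Complex.normSq_nonneg _) (abs_nonneg b)
      linarith) x hx
  rw [Complex.normSq_eq_norm_sq] at hle
  exact (Real.le_sqrt_of_sq_le hle).trans (by linarith)
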